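/- For $\omega\in\mathbb{R}$ let $\Delta$ be the bounded operator on $\ell^2(\mathbb{Z}^2)$ given by \begin{align*} \Delta f(m,n)={}& e^{-3i\omega m} f(m,n+1)+e^{3i\omega m} f(m,n-1) +e^{3i\omega n} f(m+1,n)+e^{-3i\omega n} f(m-1,n)\\ &+e^{-3i\omega(m+n)} f(m-1,n+1)+e^{3i\omega(m+n)} f(m+1,n-1). \end{align*} If $\omega\in\frac{\pi}{6}+\pi\mathbb{Z}$ or $\omega\in-\frac{\pi}{6}+\pi\mathbb{Z}$, then $\Delta$ is self-adjoint and its spectrum is purely absolutely continuous (for every $\psi\in\ell^2(\mathbb{Z}^2)$ the spectral measure of $\Delta$ at $\psi$ is absolutely continuous with respect to Lebesgue measure on $\mathbb{R}$), and \[ \operatorname{spec}\Delta=\big[-2\sqrt3,-\sqrt3\,\big]\cup\big[\sqrt3,2\sqrt3\,\big]. \] -/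

import Mathlib

open MeasureTheory
open scoped lp BoundedContinuousFunction

noncomputable section

namespace MagneticLattice

/-- The Hilbert space `ℓ²(ℤ²)` of complex-valued square-summable functions. -/
abbrev L2Z2 : Type := lp (fun _ : ℤ × ℤ => ℂ) 2

theorem memlp_phase_shift (a : ℤ × ℤ → ℝ) (v : ℤ × ℤ) (f : L2Z2) :
    Memℓp (fun x : ℤ × ℤ => Complex.exp (Complex.I * (a x : ℂ)) * f (x + v)) 2 := by
  have h2 : 0 < (2 : ENNReal).toReal := by norm_num
  have hf := (memℓp_gen_iff h2).1 (lp.memℓp f)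
  refine (memℓp_gen_iff h2).2 ?_
  have hs := (Equiv.addRight v).summable_iff.2 hf
  refine hs.congr fun x => ?_
  simp [mul_comm Complex.I, Complex.norm_exp_ofReal_mul_I]

/-- The magnetic translation `f ↦ (x ↦ e^{i a(x)} f(x + v))`, an isometry of `ℓ²(ℤ²)`. -/
def phaseShift (a : ℤ × ℤ → ℝ) (v : ℤ × ℤ) : L2Z2 →ₗᵢ[ℂ] L2Z2 where
  toFun f := ⟨fun x => Complex.exp (Complex.I * (a x : ℂ)) * f (x + v), memlp_phase_shift a v f⟩
  map_add' f g := by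
    ext x
    exact mul_add _ _ _
  map_smul' c f := by
    ext x
    simp [mul_left_comm]
  norm_map' f := by
    have h2 : 0 < (2 : ENNReal).toReal := by norm_num
    rw [lp.norm_eq_tsum_rpow h2, lp.norm_eq_tsum_rpow h2,
      ← (Equiv.addRight v).tsum_eq (fun x => ‖f x‖ ^ (2 : ENNReal).toReal)]
    congr 1
    refine tsum_congr fun x => ?_
    simp [mul_comm Complex.I, Complex.norm_exp_ofReal_mul_I]

/-- The magnetic tight-binding operator `Δ` of the triangular lattice, with magnetic
parameter `ω`, as a bounded operator on `ℓ²(ℤ²)`. -/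
def Delta (ω : ℝ) : L2Z2 →L[ℂ] L2Z2 :=
  (phaseShift (fun x => -3 * ω * x.1) (0, 1)).toContinuousLinearMap
    + (phaseShift (fun x => 3 * ω * x.1) (0, -1)).toContinuousLinearMap
    + (phaseShift (fun x => 3 * ω * x.2) (1, 0)).toContinuousLinearMap
    + (phaseShift (fun x => -3 * ω * x.2) (-1, 0)).toContinuousLinearMap
    + (phaseShift (fun x => -3 * ω * (x.1 + x.2)) (-1, 1)).toContinuousLinearMap
    + (phaseShift (fun x => 3 * ω * (x.1 + x.2)) (1, -1)).toContinuousLinearMap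

/-- The pointwise formula for `Δ`. -/
theorem Delta_apply (ω : ℝ) (f : L2Z2) (m n : ℤ) :
    Delta ω f (m, n) =
      Complex.exp (-3 * Complex.I * ω * m) * f (m, n + 1)
      + Complex.exp (3 * Complex.I * ω * m) * f (m, n - 1)
      + Complex.exp (3 * Complex.I * ω * n) * f (m + 1, n)
      + Complex.exp (-3 * Complex.I * ω * n) * f (m - 1, n)
      + Complex.exp (-3 * Complex.I * ω * (m + n)) * f (m - 1, n + 1)
      + Complex.exp (3 * Complex.I * ω * (m + n)) * f (m + 1, n - 1) := by
  simp only [Delta, phaseShift, _root_.add_apply, lp.coeFn_add, Pi.add_apply,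
    LinearIsometry.coe_toContinuousLinearMap, LinearIsometry.coe_mk, LinearMap.coe_mk,
    AddHom.coe_mk, Prod.mk_add_mk, add_zero, ← sub_eq_add_neg]
  push_cast
  ring_nf

/-- `μ` is the (scalar) spectral measure of the bounded self-adjoint operator `A` at the
vector `ψ`: the finite Borel measure on `ℝ` with `⟨ψ, g(A) ψ⟩ = ∫ g dμ` for every bounded
continuous `g`, where `g(A)` is given by the continuous functional calculus. -/
def IsSpectralMeasure {H : Type*} [NormedAddCommGroup H] [InnerProductSpace ℂ H]
    [CompleteSpace H] (A : H →L[ℂ] H) (ψ : H) (μ : Measure ℝ) : Prop :=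
  IsFiniteMeasure μ ∧
    ∀ g : ℝ →ᵇ ℝ, inner ℂ ψ ((cfc (fun t : ℝ => g t) A) ψ) = ((∫ t, g t ∂μ : ℝ) : ℂ)

/-- `A` is self-adjoint with purely absolutely continuous spectrum: the spectral measure of
every vector is absolutely continuous with respect to Lebesgue measure. -/
def HasPurelyACSpectrum {H : Type*} [NormedAddCommGroup H] [InnerProductSpace ℂ H]
    [CompleteSpace H] (A : H →L[ℂ] H) : Prop :=
  IsSelfAdjoint A ∧ ∀ ψ : H, ∃ μ : Measure ℝ, IsSpectralMeasure A ψ μ ∧ μ ≪ volume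

end MagneticLattice

end

noncomputable section

namespace MagneticLattice

/-! ### Spectral measures of a self-adjoint operator and the closed subspace of absolutely
continuous vectors -/

section SpectralMeasure

variable {H : Type*} [NormedAddCommGroup H] [InnerProductSpace ℂ H] [CompleteSpace H]

/-! For these ω the number s = exp(3iω) satisfies s² = -1, so magnetic steps in two non-parallel
lattice directions anticommute. In Δ² the mixed products therefore cancel, leaving 6 plus the
squares of the six steps. These squares are words in two commuting unitaries U, V that translate by
2 (`Delta_sq`), so Δ² = 3 + N*N with N = 1 + U + V. Its symbol is `disp` = 3 + |1 + e^{ix} +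
e^{iy}|², with range [3, 12].

Since ‖N‖ ≤ 3, every t in the spectrum has 3 ≤ t² ≤ 12. At a point vector the even moments of Δ are
torus averages of powers of `disp`. The odd moments vanish, because an odd number of steps cannot
end in the same coset of 2ℤ². The spectral measure is therefore `ptMeasure`, the symmetrised image
of normalised Lebesgue measure under ±√`disp`.

This measure is absolutely continuous because `disp` pulls null sets back to null sets. Absolutely
continuous vectors form a closed subspace, and point vectors span a dense one, so the property holds
for every ψ. Finally, `ptMeasure` is carried by the spectrum and charges every neighbourhood of each
value ±√`disp`, so the bands are filled. -/

theorem inner_apply_eq_re_of_isSelfAdjoint {T : H →L[ℂ] H} (hT : IsSelfAdjoint T) (ψ : H) :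
    inner ℂ ψ (T ψ) = ((inner ℂ ψ (T ψ)).re : ℂ) := by
  refine (Complex.conj_eq_iff_re.1 ?_).symm
  rw [inner_conj_symm, ← ContinuousLinearMap.adjoint_inner_right, hT.adjoint_eq]

/-- Riesz–Markov–Kakutani for the positive functional f ↦ Re⟨ψ, f(A)ψ⟩ on the compact spectrum,
pushed forward to ℝ. -/
theorem exists_isSpectralMeasure {A : H →L[ℂ] H} (hA : IsSelfAdjoint A) (ψ : H) :
    ∃ μ : Measure ℝ, IsSpectralMeasure A ψ μ := by
  let X := spectrum ℝ A
  have : CompactSpace X := isCompact_iff_compactSpace.1 (spectrum.isCompact A)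
  let Λ : CompactlySupportedContinuousMap X ℝ →ₚ[ℝ] ℝ := PositiveLinearMap.mk₀
    { toFun := fun f => (inner ℂ ψ (cfcHom hA f.toContinuousMap ψ)).re
      map_add' := fun f g => by
        have : (f + g).toContinuousMap = f.toContinuousMap + g.toContinuousMap := rfl
        simp [this]
      map_smul' := fun c f => by
        have : (c • f).toContinuousMap = c • f.toContinuousMap := rfl
        simp [this, inner_smul_right_eq_smul] }
    (fun f hf => by
      have h : 0 ≤ cfcHom hA f.toContinuousMap := (cfcHom_nonneg_iff hA).2 hf
      have := ((ContinuousLinearMap.nonneg_iff_isPositive _).1 h).inner_nonneg_right ψ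
      exact (Complex.le_def.1 this).1)
  let o : CompactlySupportedContinuousMap X ℝ :=
    { toFun := 1
      hasCompactSupport' := HasCompactSupport.of_compactSpace 1 }
  have : IsFiniteMeasure (RealRMK.rieszMeasure Λ) := ⟨lt_of_le_of_lt
    (RealRMK.rieszMeasure_le_of_eq_one Λ (f := o) (fun x => by simp [o]) isCompact_univ
      (fun x => by simp [o])) ENNReal.ofReal_lt_top⟩
  refine ⟨(RealRMK.rieszMeasure Λ).map Subtype.val, inferInstance, fun g => ?_⟩
  rw [inner_apply_eq_re_of_isSelfAdjoint (cfc_predicate _ A) ψ,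
    integral_map measurable_subtype_coe.aemeasurable g.continuous.aestronglyMeasurable]
  let f : CompactlySupportedContinuousMap X ℝ :=
    { toFun := fun x => g x
      continuous_toFun := g.continuous.comp continuous_subtype_val
      hasCompactSupport' := HasCompactSupport.of_compactSpace _ }
  have h := RealRMK.integral_rieszMeasure Λ f
  rw [cfc_apply (fun t => g t) A hA g.continuous.continuousOn]
  exact congrArg _ h.symm

theorem IsSpectralMeasure.parallelogram {A : H →L[ℂ] H} {φ χ : H} {μ₁ μ₂ μ ν : Measure ℝ}
    (h₁ : IsSpectralMeasure A (φ + χ) μ₁) (h₂ : IsSpectralMeasure A (φ - χ) μ₂)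
    (hμ : IsSpectralMeasure A φ μ) (hν : IsSpectralMeasure A χ ν) :
    μ₁ + μ₂ = (μ + μ) + (ν + ν) := by
  have := h₁.1
  have := h₂.1
  have := hμ.1
  have := hν.1
  refine ext_of_forall_integral_eq_of_IsFiniteMeasure fun g => ?_
  rw [integral_add_measure (g.integrable _) (g.integrable _),
    integral_add_measure (g.integrable _) (g.integrable _),
    integral_add_measure (g.integrable _) (g.integrable _),
    integral_add_measure (g.integrable _) (g.integrable _)]
  apply Complex.ofReal_injective
  push_cast
  rw [← h₁.2 g, ← h₂.2 g, ← hμ.2 g, ← hν.2 g]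
  simp only [map_add, map_sub, inner_add_left, inner_add_right, inner_sub_left, inner_sub_right]
  ring

/-- Drop the measure at φ - χ from the parallelogram identity. This gives closure of absolute
continuity under sums and under limits. -/
theorem IsSpectralMeasure.le_two_mul {A : H →L[ℂ] H} (hA : IsSelfAdjoint A) {φ χ : H}
    {μ₁ μ ν : Measure ℝ} (h₁ : IsSpectralMeasure A (φ + χ) μ₁)
    (hμ : IsSpectralMeasure A φ μ) (hν : IsSpectralMeasure A χ ν) (s : Set ℝ) :
    μ₁ s ≤ (μ s + μ s) + (ν s + ν s) := by
  obtain ⟨μ₂, h₂⟩ := exists_isSpectralMeasure hA (φ - χ)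
  have := congrArg (fun m : Measure ℝ => m s) (h₁.parallelogram h₂ hμ hν)
  simp only [Measure.coe_add, Pi.add_apply] at this
  exact le_self_add.trans this.le

theorem IsSpectralMeasure.measure_univ {A : H →L[ℂ] H} (hA : IsSelfAdjoint A) {ψ : H}
    {μ : Measure ℝ} (h : IsSpectralMeasure A ψ μ) :
    μ Set.univ = ENNReal.ofReal (‖ψ‖ ^ 2) := by
  have := h.1
  have h1 := h.2 (BoundedContinuousFunction.const ℝ 1)
  have h2 : cfc (fun _ : ℝ => (1 : ℝ)) A = 1 := cfc_const_one ℝ A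
  simp only [BoundedContinuousFunction.const_apply, h2, one_apply_eq_self,
    inner_self_eq_norm_sq_to_K, integral_const, smul_eq_mul, mul_one] at h1
  rw [← ofReal_measureReal]
  congr 1
  apply Complex.ofReal_injective
  rw [← h1]
  push_cast
  rfl

/-- The vectors with absolutely continuous spectral measure. -/
def HasACSpectralMeasure (A : H →L[ℂ] H) (ψ : H) : Prop :=
  ∃ μ : Measure ℝ, IsSpectralMeasure A ψ μ ∧ μ ≪ volume

theorem HasACSpectralMeasure.add {A : H →L[ℂ] H} (hA : IsSelfAdjoint A) {φ χ : H}
    (hφ : HasACSpectralMeasure A φ) (hχ : HasACSpectralMeasure A χ) :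
    HasACSpectralMeasure A (φ + χ) := by
  obtain ⟨μ, hμ, hμac⟩ := hφ
  obtain ⟨ν, hν, hνac⟩ := hχ
  obtain ⟨μ₁, h₁⟩ := exists_isSpectralMeasure hA (φ + χ)
  refine ⟨μ₁, h₁, fun s hs => ?_⟩
  have := h₁.le_two_mul hA hμ hν s
  simpa [hμac hs, hνac hs] using this

theorem HasACSpectralMeasure.smul {A : H →L[ℂ] H} (c : ℂ) {φ : H}
    (hφ : HasACSpectralMeasure A φ) : HasACSpectralMeasure A (c • φ) := by
  obtain ⟨μ, ⟨hfin, hμ⟩, hμac⟩ := hφ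
  refine ⟨(‖c‖₊ ^ 2) • μ, ⟨inferInstance, fun g => ?_⟩, hμac.smul_left _⟩
  rw [map_smul, inner_smul_left, inner_smul_right, hμ g, integral_smul_nnreal_measure,
    ← mul_assoc, mul_comm _ c, Complex.mul_conj', NNReal.smul_def]
  push_cast
  simp

theorem hasACSpectralMeasure_zero {A : H →L[ℂ] H} : HasACSpectralMeasure A 0 :=
  ⟨0, ⟨inferInstance, fun g => by simp⟩, Measure.AbsolutelyContinuous.zero _⟩

theorem isClosed_hasACSpectralMeasure {A : H →L[ℂ] H} (hA : IsSelfAdjoint A) :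
    IsClosed {ψ | HasACSpectralMeasure A ψ} := by
  refine isClosed_of_closure_subset fun ψ hψ => ?_
  obtain ⟨μ, hμ⟩ := exists_isSpectralMeasure hA ψ
  refine ⟨μ, hμ, fun s hs => ?_⟩
  refine le_antisymm (ENNReal.le_of_forall_pos_le_add fun ε hε _ => ?_) zero_le
  -- The measure at ψ - φ has total mass ‖ψ - φ‖² and enters the bound twice, hence the radius
  -- √(ε/2).
  obtain ⟨φ, ⟨ν, hν, hνac⟩, hdist⟩ := Metric.mem_closure_iff.1 hψ (Real.sqrt (ε / 2))
    (Real.sqrt_pos.2 (by positivity))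
  obtain ⟨ρ, hρ⟩ := exists_isSpectralMeasure hA (ψ - φ)
  have hμ' : IsSpectralMeasure A (φ + (ψ - φ)) μ := by simpa using hμ
  have hle := hμ'.le_two_mul hA hν hρ s
  have hρs : ρ s ≤ ENNReal.ofReal (ε / 2) := by
    refine (measure_mono (Set.subset_univ s)).trans ?_
    rw [hρ.measure_univ hA]
    apply ENNReal.ofReal_le_ofReal
    rw [dist_eq_norm] at hdist
    exact ((Real.lt_sqrt (norm_nonneg _)).1 hdist).le
  rw [hνac hs] at hle
  calc μ s ≤ 0 + 0 + (ρ s + ρ s) := hle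
    _ ≤ 0 + 0 + (ENNReal.ofReal (ε / 2) + ENNReal.ofReal (ε / 2)) := by gcongr
    _ = 0 + ε := by
      rw [← ENNReal.ofReal_add (by positivity) (by positivity), add_halves,
        ENNReal.ofReal_coe_nnreal, add_zero]

/-- The vectors with absolutely continuous spectral measure form a closed subspace. -/
def acSubmodule (A : H →L[ℂ] H) (hA : IsSelfAdjoint A) : Submodule ℂ H where
  carrier := {ψ | HasACSpectralMeasure A ψ}
  add_mem' h h' := h.add hA h'
  zero_mem' := hasACSpectralMeasure_zero
  smul_mem' c _ h := h.smul c

/-- By Weierstrass approximation on [a, b], which carries both the spectrum and μ, matching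
polynomial moments suffices. -/
theorem isSpectralMeasure_of_forall_polynomial {A : H →L[ℂ] H} (hA : IsSelfAdjoint A) {ψ : H}
    {μ : Measure ℝ} [IsFiniteMeasure μ] {a b : ℝ} (hspec : spectrum ℝ A ⊆ Set.Icc a b)
    (hμ : ∀ᵐ t ∂μ, t ∈ Set.Icc a b)
    (hp : ∀ p : Polynomial ℝ, inner ℂ ψ (Polynomial.aeval A p ψ) = ((∫ t, p.eval t ∂μ : ℝ) : ℂ)) :
    IsSpectralMeasure A ψ μ := by
  refine ⟨inferInstance, fun g => ?_⟩
  set C : ℝ := ‖ψ‖ ^ 2 + μ.real Set.univ with hC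
  have hC0 : 0 ≤ C := by positivity
  rw [← sub_eq_zero, ← norm_le_zero_iff]
  refine le_of_forall_pos_le_add fun ε hε => ?_
  obtain ⟨p, hpg⟩ := exists_polynomial_near_of_continuousOn a b g g.continuous.continuousOn
    (ε / (C + 1)) (by positivity)
  set δ := ε / (C + 1) with hδ
  have hδ0 : 0 ≤ δ := by positivity
  have h1 : ‖cfc (fun t : ℝ => g t) A - Polynomial.aeval A p‖ ≤ δ := by
    rw [← cfc_polynomial p A hA, ← cfc_sub _ _ A g.continuous.continuousOn
      p.continuous.continuousOn]
    refine norm_cfc_le hδ0 fun x hx => ?_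
    rw [Real.norm_eq_abs, abs_sub_comm]
    exact (hpg x (hspec hx)).le
  have hpint : Integrable (fun t => p.eval t) μ := by
    have hbdd := (isCompact_Icc (a := a) (b := b)).exists_bound_of_continuousOn
      p.continuous.continuousOn
    obtain ⟨B, hB⟩ := hbdd
    exact Integrable.of_bound p.continuous.aestronglyMeasurable B (hμ.mono fun t ht => hB t ht)
  have h2 : ‖∫ t, (p.eval t - g t) ∂μ‖ ≤ δ * μ.real Set.univ :=
    norm_integral_le_of_norm_le_const (hμ.mono fun t ht => (hpg t ht).le)
  have h3 : inner ℂ ψ (cfc (fun t : ℝ => g t) A ψ) - ((∫ t, g t ∂μ : ℝ) : ℂ)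
      = inner ℂ ψ ((cfc (fun t : ℝ => g t) A - Polynomial.aeval A p) ψ)
        + ((∫ t, (p.eval t - g t) ∂μ : ℝ) : ℂ) := by
    rw [integral_sub hpint (g.integrable μ), sub_apply, inner_sub_right, hp p]
    push_cast
    ring
  rw [h3, zero_add]
  calc _ ≤ ‖ψ‖ * (δ * ‖ψ‖) + δ * μ.real Set.univ := by
        refine (norm_add_le _ _).trans (add_le_add ?_ ?_)
        · refine (norm_inner_le_norm _ _).trans ?_
          gcongr
          exact ContinuousLinearMap.le_of_opNorm_le _ h1 ψ
        · rwa [Complex.norm_real]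
    _ = δ * C := by rw [hC]; ring
    _ ≤ δ * (C + 1) := by gcongr; linarith
    _ = ε := by rw [hδ]; field_simp

/-- Test against the truncated distance to the spectrum: it vanishes on the spectrum, so its
functional calculus is 0, yet it is positive elsewhere. Nonemptiness matters because
`Metric.infDist` to the empty set is 0. -/
theorem IsSpectralMeasure.measure_compl_spectrum {A : H →L[ℂ] H} {ψ : H}
    {μ : Measure ℝ} (h : IsSpectralMeasure A ψ μ) (hne : (spectrum ℝ A).Nonempty) :
    μ (spectrum ℝ A)ᶜ = 0 := by
  have := h.1
  let g : ℝ →ᵇ ℝ := BoundedContinuousFunction.ofNormedAddCommGroup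
    (fun t => min (Metric.infDist t (spectrum ℝ A)) 1)
    ((Metric.continuous_infDist_pt _).min continuous_const) 1 fun t => by
      rw [Real.norm_of_nonneg (le_min Metric.infDist_nonneg zero_le_one)]
      exact min_le_right _ _
  have h0 : cfc (fun t => g t) A = 0 := by
    rw [cfc_congr (g := fun _ => (0 : ℝ)) (fun t ht => ?_), cfc_const_zero]
    simp [g, Metric.infDist_zero_of_mem ht]
  have hint := h.2 g
  have hg : 0 ≤ (fun t => g t) := fun t => le_min Metric.infDist_nonneg zero_le_one
  rw [h0, zero_apply, inner_zero_right, eq_comm, Complex.ofReal_eq_zero,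
    integral_eq_zero_iff_of_nonneg hg (g.integrable μ)] at hint
  refine measure_mono_null (fun t ht => ?_) (ae_iff.1 hint)
  rw [Set.mem_ofPred_eq]
  intro h0
  have hpos := ((spectrum.isCompact (𝕜 := ℝ) A).isClosed.notMem_iff_infDist_pos hne).1 ht
  exact (lt_min hpos one_pos).ne' h0

end SpectralMeasure

/-! ### The dispersion relation: range and preimages of null sets -/

section Dispersion

/-- The dispersion relation of `Δ²`. -/
def disp (z : ℝ × ℝ) : ℝ :=
  3 + (1 + Real.cos z.1 + Real.cos z.2) ^ 2 + (Real.sin z.1 + Real.sin z.2) ^ 2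

theorem continuous_disp : Continuous disp := by
  unfold disp
  fun_prop

/-- From 1 + e^{ix} = 2 cos(x/2) e^{ix/2}. For fixed x this is affine in cos(y - x/2), with nonzero
slope for almost every x, which is what the Fubini argument for null preimages needs. -/
theorem disp_eq_half_angle (x y : ℝ) :
    disp (x, y) = 6 + 2 * Real.cos x + 4 * Real.cos (x / 2) * Real.cos (y - x / 2) := by
  have hx : x = x / 2 + x / 2 := by ring
  have hy : y = (y - x / 2) + x / 2 := by ring
  simp only [disp]
  generalize hu : x / 2 = u at *
  generalize hv : y - u = v at *
  rw [hy, hx]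
  simp only [Real.cos_add, Real.sin_add]
  have h1 := Real.sin_sq_add_cos_sq u
  have h2 := Real.sin_sq_add_cos_sq v
  grind

theorem three_le_disp (z : ℝ × ℝ) : 3 ≤ disp z := by
  unfold disp
  nlinarith [sq_nonneg (1 + Real.cos z.1 + Real.cos z.2), sq_nonneg (Real.sin z.1 + Real.sin z.2)]

theorem disp_le_twelve (z : ℝ × ℝ) : disp z ≤ 12 := by
  unfold disp
  nlinarith [Real.sin_sq_add_cos_sq z.1, Real.sin_sq_add_cos_sq z.2, Real.cos_le_one z.1,
    Real.cos_le_one z.2, sq_nonneg (Real.cos z.1 - Real.cos z.2),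
    sq_nonneg (Real.sin z.1 - Real.sin z.2)]

theorem exists_disp_eq {t : ℝ} (h3 : 3 ≤ t) (h12 : t ≤ 12) :
    ∃ z ∈ Set.Icc (-Real.pi) Real.pi ×ˢ Set.Icc (-Real.pi) Real.pi, disp z = t := by
  -- On the line y = -x, `disp` is 3 + (1 + 2 cos x)²; solve 1 + 2c = √(t - 3) for c = cos x.
  set c := (Real.sqrt (t - 3) - 1) / 2 with hc
  have hs0 := Real.sqrt_nonneg (t - 3)
  have hs : Real.sqrt (t - 3) ≤ 3 := Real.sqrt_le_iff.2 ⟨by norm_num, by linarith⟩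
  have hcos : Real.cos (Real.arccos c) = c := Real.cos_arccos (by linarith) (by linarith)
  have h0 := Real.arccos_nonneg c
  have h1 := Real.arccos_le_pi c
  refine ⟨(Real.arccos c, -Real.arccos c), ⟨⟨by linarith, h1⟩, ⟨by linarith, by linarith⟩⟩, ?_⟩
  simp only [disp, Real.cos_neg, Real.sin_neg, hcos]
  have := Real.sq_sqrt (show 0 ≤ t - 3 by linarith)
  rw [hc]
  linarith

/-- Away from the countable set πℤ, the preimage is covered by translates and reflections of the
`arccos` image of s ∩ (-1, 1). That image is null, since `arccos` is differentiable there. -/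
theorem volume_cos_preimage_eq_zero {s : Set ℝ} (hs : volume s = 0) :
    volume (Real.cos ⁻¹' s) = 0 := by
  have harc : volume (Real.arccos '' (s ∩ Set.Ioo (-1) 1)) = 0 := by
    refine addHaar_image_eq_zero_of_differentiableOn_of_addHaar_eq_zero volume
      (fun t ht => ?_) (measure_mono_null Set.inter_subset_left hs)
    exact (Real.differentiableAt_arccos.2 ⟨ht.2.1.ne', ht.2.2.ne⟩).differentiableWithinAt
  set T := Real.arccos '' (s ∩ Set.Ioo (-1) 1) with hT
  have hsub : Real.cos ⁻¹' s ⊆ Set.range (fun k : ℤ => k * Real.pi) ∪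
      ⋃ k : ℤ, ((fun x => x + k * (2 * Real.pi)) ⁻¹' T ∪
        (fun x => -x + k * (2 * Real.pi)) ⁻¹' T) := by
    intro x hx
    by_cases hsin : Real.sin x = 0
    · obtain ⟨k, hk⟩ := Real.sin_eq_zero_iff.1 hsin
      exact Or.inl ⟨k, hk⟩
    right
    have hcos : Real.cos x ∈ Set.Ioo (-1 : ℝ) 1 := by
      have := Real.sin_sq_add_cos_sq x
      have hpos : 0 < Real.sin x ^ 2 := by positivity
      exact abs_lt.1 ((sq_lt_one_iff_abs_lt_one _).1 (by linarith))
    have hmem : Real.arccos (Real.cos x) ∈ T := ⟨_, ⟨hx, hcos⟩, rfl⟩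
    have hcc : Real.cos (Real.arccos (Real.cos x)) = Real.cos x :=
      Real.cos_arccos hcos.1.le hcos.2.le
    obtain ⟨k, hk⟩ := Real.cos_eq_cos_iff.1 hcc
    refine Set.mem_iUnion.2 ?_
    rcases hk with hk | hk
    · refine ⟨-k, Or.inl ?_⟩
      have : x + ((-k : ℤ) : ℝ) * (2 * Real.pi) = Real.arccos (Real.cos x) := by
        push_cast
        linarith
      rwa [Set.mem_preimage, this]
    · refine ⟨k, Or.inr ?_⟩
      have : -x + (k : ℝ) * (2 * Real.pi) = Real.arccos (Real.cos x) := by linarith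
      rwa [Set.mem_preimage, this]
  refine measure_mono_null hsub (measure_union_null ((Set.countable_range _).measure_zero _) ?_)
  refine measure_iUnion_null fun k => measure_union_null ?_ ?_
  · exact (measurePreserving_add_right volume _).quasiMeasurePreserving.preimage_null harc
  · exact ((measurePreserving_add_right volume _).comp
      (Measure.measurePreserving_neg volume)).quasiMeasurePreserving.preimage_null harc

theorem volume_disp_preimage_eq_zero {s : Set ℝ} (hs : volume s = 0) :
    volume (disp ⁻¹' s) = 0 := by
  -- Fubini for null sets requires measurability, so s is replaced by its measurable hull.
  wlog hmeas : MeasurableSet s generalizing s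
  · exact measure_mono_null (Set.preimage_mono (subset_toMeasurable volume s))
      (this ((measure_toMeasurable s).trans hs) (measurableSet_toMeasurable volume s))
  rw [Measure.volume_eq_prod, Measure.measure_prod_null (continuous_disp.measurable hmeas)]
  have hne : ∀ᵐ x : ℝ, Real.cos (x / 2) ≠ 0 := by
    refine Set.Countable.ae_notMem (s := {x | Real.cos (x / 2) = 0}) ?_ volume
    refine (Set.countable_range fun k : ℤ => (2 * k + 1) * Real.pi).mono fun x hx => ?_
    obtain ⟨k, hk⟩ := Real.cos_eq_zero_iff.1 hx
    exact ⟨k, by simp only; linarith⟩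
  filter_upwards [hne] with x hx
  have hlin : volume ((fun c => 6 + 2 * Real.cos x + 4 * Real.cos (x / 2) * c) ⁻¹' s) = 0 := by
    have h4 : 4 * Real.cos (x / 2) ≠ 0 := by positivity
    have : (fun c => 6 + 2 * Real.cos x + 4 * Real.cos (x / 2) * c) ⁻¹' s =
        (fun c => 4 * Real.cos (x / 2) * c) ⁻¹' ((fun c => 6 + 2 * Real.cos x + c) ⁻¹' s) := rfl
    rw [this, Real.volume_preimage_mul_left h4, measure_preimage_add, hs, mul_zero]
  have := (measurePreserving_sub_right volume (x / 2)).quasiMeasurePreserving.preimage_null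
    (volume_cos_preimage_eq_zero hlin)
  refine measure_mono_null (fun y hy => ?_) this
  simpa [disp_eq_half_angle] using hy

theorem volume_sqrt_disp_preimage_eq_zero {s : Set ℝ} (hs : volume s = 0) :
    volume ((fun z => Real.sqrt (disp z)) ⁻¹' s) = 0 ∧
      volume ((fun z => -Real.sqrt (disp z)) ⁻¹' s) = 0 := by
  have hsq : volume ((fun t : ℝ => t ^ 2) '' s) = 0 :=
    addHaar_image_eq_zero_of_differentiableOn_of_addHaar_eq_zero volume (by fun_prop) hs
  have hd : ∀ z, 0 ≤ disp z := fun z => by linarith [three_le_disp z]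
  constructor <;> refine measure_mono_null (fun z hz => ?_) (volume_disp_preimage_eq_zero hsq)
  · exact ⟨_, hz, Real.sq_sqrt (hd z)⟩
  · exact ⟨_, hz, by simp only [neg_sq, Real.sq_sqrt (hd z)]⟩

end Dispersion

/-! ### Magnetic translations and the square of Δ at flux π -/

section Operators

/-- An isometry T with a right inverse S satisfies T* = T*(TS) = S. -/
theorem star_phaseShift {a b : ℤ × ℤ → ℝ} {v w : ℤ × ℤ} (hvw : v + w = 0)
    (hab : ∀ x, a x + b (x + v) = 0) :
    star (phaseShift a v).toContinuousLinearMap = (phaseShift b w).toContinuousLinearMap := by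
  set T := (phaseShift a v).toContinuousLinearMap
  set S := (phaseShift b w).toContinuousLinearMap
  have h1 : star T * T = 1 := (phaseShift a v).adjoint_comp_self
  have h2 : T * S = 1 := by
    ext f x
    change Complex.exp _ * (Complex.exp _ * f (x + v + w)) = f x
    rw [add_assoc, hvw, add_zero, ← mul_assoc, ← Complex.exp_add, ← mul_add, ← Complex.ofReal_add,
      hab x]
    simp
  calc star T = star T * (T * S) := by rw [h2, mul_one]
    _ = S := by rw [← mul_assoc, h1, one_mul]

theorem isSelfAdjoint_Delta (ω : ℝ) : IsSelfAdjoint (Delta ω) := by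
  have h1 : star (phaseShift (fun x => -3 * ω * x.1) (0, 1)).toContinuousLinearMap =
      (phaseShift (fun x => 3 * ω * x.1) (0, -1)).toContinuousLinearMap :=
    star_phaseShift rfl fun x => by simp
  have h2 : star (phaseShift (fun x => 3 * ω * x.2) (1, 0)).toContinuousLinearMap =
      (phaseShift (fun x => -3 * ω * x.2) (-1, 0)).toContinuousLinearMap :=
    star_phaseShift rfl fun x => by simp
  have h3 : star (phaseShift (fun x => -3 * ω * (x.1 + x.2)) (-1, 1)).toContinuousLinearMap =
      (phaseShift (fun x => 3 * ω * (x.1 + x.2)) (1, -1)).toContinuousLinearMap :=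
    star_phaseShift rfl fun x => by simp; ring
  unfold IsSelfAdjoint Delta
  simp only [star_add, ← h1, ← h2, ← h3, star_star]
  abel

/-- The translations of the sublattice `2ℤ × 2ℤ`, with the phases of `Δ²` at flux `π`. -/
def evenShift (a : ℤ × ℤ) : L2Z2 →L[ℂ] L2Z2 :=
  (phaseShift (fun x => Real.pi * (a.1 * x.1 + a.2 * x.2))
    (2 * a.2, 2 * a.1)).toContinuousLinearMap

theorem evenShift_apply (a : ℤ × ℤ) (f : L2Z2) (m n : ℤ) :
    evenShift a f (m, n) =
      (-1) ^ (a.1 * m + a.2 * n) * f (m + 2 * a.2, n + 2 * a.1) := by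
  have h : Complex.exp (Complex.I * ((Real.pi * (a.1 * m + a.2 * n) : ℝ) : ℂ)) =
      (-1) ^ (a.1 * m + a.2 * n) := by
    rw [← Complex.exp_pi_mul_I, ← Complex.exp_int_mul]
    push_cast
    ring_nf
  rw [← h]
  rfl

theorem neg_one_zpow_eq_of_even {k l : ℤ} (h : Even (k - l)) : (-1 : ℂ) ^ k = (-1) ^ l := by
  rw [← sub_add_cancel k l, zpow_add₀ (by norm_num), h.neg_one_zpow, one_mul]

/-- The representation of `ℤ × ℤ` by even translations. -/
def evenShiftHom : Multiplicative (ℤ × ℤ) →* (L2Z2 →L[ℂ] L2Z2) where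
  toFun a := evenShift a.toAdd
  map_one' := by
    ext f ⟨m, n⟩
    simp [evenShift_apply]
  map_mul' a b := by
    ext f ⟨m, n⟩
    rw [mul_apply_eq_comp, evenShift_apply, evenShift_apply, evenShift_apply,
      ← mul_assoc, ← zpow_add₀ (by norm_num)]
    simp only [toAdd_mul, Prod.fst_add, Prod.snd_add]
    -- Translations by even vectors preserve the parities of m and n, so the signs multiply without
    -- a cocycle.
    rw [neg_one_zpow_eq_of_even (l := a.toAdd.1 * m + a.toAdd.2 * n + (b.toAdd.1 *
      (m + 2 * a.toAdd.2) + b.toAdd.2 * (n + 2 * a.toAdd.1)))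
      ⟨-(b.toAdd.1 * a.toAdd.2 + b.toAdd.2 * a.toAdd.1), by ring⟩]
    ring_nf

/-- Laurent polynomials in two variables. -/
abbrev Laurent : Type := AddMonoidAlgebra ℂ (ℤ × ℤ)

/-- Laurent polynomials in the even translations. -/
def evenRep : Laurent →ₐ[ℂ] (L2Z2 →L[ℂ] L2Z2) := AddMonoidAlgebra.lift ℂ _ _ evenShiftHom

theorem evenRep_single (a : ℤ × ℤ) (c : ℂ) :
    evenRep (AddMonoidAlgebra.single a c) = c • evenShift a :=
  AddMonoidAlgebra.lift_single _ _ _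

/-- The symbol of `Δ²`. -/
def symb : Laurent :=
  AddMonoidAlgebra.single 0 6 + AddMonoidAlgebra.single (1, 0) 1 +
    AddMonoidAlgebra.single (-1, 0) 1 + AddMonoidAlgebra.single (0, 1) 1 +
    AddMonoidAlgebra.single (0, -1) 1 + AddMonoidAlgebra.single (1, -1) 1 +
    AddMonoidAlgebra.single (-1, 1) 1

theorem Delta_apply_zpow (ω : ℝ) (f : L2Z2) (m n : ℤ) :
    Delta ω f (m, n) =
      Complex.exp (3 * Complex.I * ω) ^ (-m) * f (m, n + 1)
      + Complex.exp (3 * Complex.I * ω) ^ m * f (m, n - 1)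
      + Complex.exp (3 * Complex.I * ω) ^ n * f (m + 1, n)
      + Complex.exp (3 * Complex.I * ω) ^ (-n) * f (m - 1, n)
      + Complex.exp (3 * Complex.I * ω) ^ (-(m + n)) * f (m - 1, n + 1)
      + Complex.exp (3 * Complex.I * ω) ^ (m + n) * f (m + 1, n - 1) := by
  rw [Delta_apply]
  simp only [← Complex.exp_int_mul]
  push_cast
  ring_nf

theorem exp_three_mul_sq {ω : ℝ}
    (hω : ∃ k : ℤ, ω = Real.pi / 6 + k * Real.pi ∨ ω = -(Real.pi / 6) + k * Real.pi) :
    Complex.exp (3 * Complex.I * ω) ^ 2 = -1 := by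
  rw [← Complex.exp_nat_mul]
  obtain ⟨k, rfl | rfl⟩ := hω
  · rw [Complex.exp_eq_exp_iff_exists_int.2 ⟨3 * k, ?_⟩, Complex.exp_pi_mul_I]
    push_cast
    ring
  · rw [Complex.exp_eq_exp_iff_exists_int.2 ⟨3 * k - 1, ?_⟩, Complex.exp_pi_mul_I]
    push_cast
    ring

/-- Of the 36 products of steps, the 6 opposite pairs give the constant 6, the 6 squares give the
even translations, and the remaining 24 cancel in anticommuting pairs. -/
theorem Delta_sq {ω : ℝ} (hs : Complex.exp (3 * Complex.I * ω) ^ 2 = -1) :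
    Delta ω ^ 2 = evenRep symb := by
  ext f ⟨m, n⟩
  simp only [symb, map_add, evenRep_single, one_smul, _root_.add_apply, lp.coeFn_add, Pi.add_apply,
    evenShift_apply, pow_two, mul_apply_eq_comp, _root_.smul_apply, lp.coeFn_smul,
    Pi.smul_apply, smul_eq_mul]
  simp only [Delta_apply_zpow]
  generalize Complex.exp (3 * Complex.I * ω) = s at *
  have hs0 : s ≠ 0 := by rintro rfl; norm_num at hs
  have hsi : s⁻¹ = -s := by
    refine inv_eq_of_mul_eq_one_left ?_
    linear_combination -hs
  -- With u = s^m and v = s^n, all phases become monomials in u, v, s modulo u⁴ = v⁴ = 1 and s² =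
  -- -1, and the identity becomes polynomial.
  have h4 : ∀ k : ℤ, (s ^ k) ^ 4 = 1 := fun k => by
    rw [← zpow_natCast, zpow_comm]
    norm_num
    rw [show s ^ 4 = 1 by linear_combination (s ^ 2 - 1) * hs, one_zpow]
  have hm1 : ∀ k : ℤ, (-1 : ℂ) ^ k = (s ^ k) ^ 2 := fun k => by
    rw [← hs, ← zpow_natCast, ← zpow_natCast, zpow_comm]
  have hinv : ∀ k : ℤ, (s ^ k)⁻¹ = (s ^ k) ^ 3 := fun k =>
    inv_eq_of_mul_eq_one_left (by linear_combination h4 k)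
  simp only [neg_add, sub_eq_add_neg, neg_neg, Prod.fst_zero, Prod.snd_zero, zpow_add₀ hs0, zpow_neg,
     hm1, hinv, zpow_one, mul_neg, neg_mul,
    mul_one, one_mul, mul_zero, zero_mul, zero_add, add_zero, hsi, zpow_zero]
  simp only [add_assoc, Int.reduceAdd, Int.reduceNeg, add_zero]
  have hu := h4 m
  have hv := h4 n
  generalize s ^ m = u at *
  generalize s ^ n = v at *
  have hu3 : u ^ 6 = u ^ 2 := by linear_combination u ^ 2 * hu
  have hv3 : v ^ 6 = v ^ 2 := by linear_combination v ^ 2 * hv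
  ring_nf
  simp only [hu, hv, hs, hu3, hv3]
  ring_nf

end Operators

/-! ### Spectral enclosure, and the spectral measure at a lattice point -/

section Spectrum

theorem evenShift_mul (a b : ℤ × ℤ) : evenShift a * evenShift b = evenShift (a + b) :=
  (evenShiftHom.map_mul (Multiplicative.ofAdd a) (Multiplicative.ofAdd b)).symm

theorem evenShift_zero : evenShift 0 = 1 := evenShiftHom.map_one

theorem evenRep_symb_eq : evenRep symb = algebraMap ℝ _ 3 +
    star (1 + evenShift (1, 0) + evenShift (0, 1)) *
      (1 + evenShift (1, 0) + evenShift (0, 1)) := by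
  have h1 : star (evenShift (1, 0)) = evenShift (-1, 0) :=
    star_phaseShift rfl fun x => by simp
  have h2 : star (evenShift (0, 1)) = evenShift (0, -1) :=
    star_phaseShift rfl fun x => by simp
  have h3 : algebraMap ℝ (L2Z2 →L[ℂ] L2Z2) 3 = 1 + 1 + 1 := by
    rw [map_ofNat]
    norm_num
  have h6 : (6 : ℂ) • (1 : L2Z2 →L[ℂ] L2Z2) = 1 + 1 + 1 + 1 + 1 + 1 := by
    module
  simp only [symb, map_add, evenRep_single, star_add, star_one, h1, h2, h3, mul_add, add_mul,
    one_mul, mul_one, evenShift_mul, one_smul, Prod.mk_add_mk, evenShift_zero, h6]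
  simp only [Int.reduceAdd, Int.reduceNeg, add_zero, zero_add, Prod.mk_zero_zero, evenShift_zero]
  abel

theorem sq_mem_Icc_of_mem_spectrum {ω : ℝ} (hs : Complex.exp (3 * Complex.I * ω) ^ 2 = -1)
    {t : ℝ} (ht : t ∈ spectrum ℝ (Delta ω)) : t ^ 2 ∈ Set.Icc (3 : ℝ) 12 := by
  have h := spectrum.pow_image_subset (Delta ω) 2 ⟨t, ht, rfl⟩
  rw [Delta_sq hs, evenRep_symb_eq] at h
  set N := (1 : L2Z2 →L[ℂ] L2Z2) + evenShift (1, 0) + evenShift (0, 1) with hN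
  have h' : t ^ 2 - 3 ∈ spectrum ℝ (star N * N) := by
    rw [← spectrum.add_mem_add_iff (s := 3)]
    simpa using h
  have hone : ‖(1 : L2Z2 →L[ℂ] L2Z2)‖ ≤ 1 := ContinuousLinearMap.norm_id_le
  have hshift : ∀ a, ‖evenShift a‖ ≤ 1 := fun a => LinearIsometry.norm_toContinuousLinearMap_le _
  have hN3 : ‖N‖ ≤ 3 := by
    refine (norm_add₃_le).trans ?_
    linarith [hshift (1, 0), hshift (0, 1)]
  have hup := spectrum.norm_le_norm_mul_of_mem h'
  have hNN : ‖star N * N‖ = ‖N‖ * ‖N‖ := ContinuousLinearMap.norm_adjoint_comp_self N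
  rw [hNN, Real.norm_eq_abs] at hup
  have h0 := spectrum_star_mul_self_nonneg _ h'
  refine ⟨by linarith, ?_⟩
  have : ‖N‖ * ‖N‖ * ‖(1 : L2Z2 →L[ℂ] L2Z2)‖ ≤ 3 * 3 * 1 := by gcongr
  linarith [le_abs_self (t ^ 2 - 3)]

/-- The characters of `ℤ × ℤ` at the points of the plane. -/
def planeHom : Multiplicative (ℤ × ℤ) →* C(ℝ × ℝ, ℂ) where
  toFun a :=
    { toFun := fun z => Complex.exp (a.toAdd.1 * Complex.I * z.1) *
        Complex.exp (a.toAdd.2 * Complex.I * z.2)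
      continuous_toFun := by fun_prop }
  map_one' := by
    ext z
    simp
  map_mul' a b := by
    ext z
    simp only [toAdd_mul, Prod.fst_add, Prod.snd_add, ContinuousMap.mul_apply,
      ContinuousMap.coe_mk, ← Complex.exp_add]
    push_cast
    ring_nf

/-- Laurent polynomials as functions on the plane. -/
def planeRep : Laurent →ₐ[ℂ] C(ℝ × ℝ, ℂ) := AddMonoidAlgebra.lift ℂ _ _ planeHom

theorem planeRep_single (a : ℤ × ℤ) (c : ℂ) (z : ℝ × ℝ) :
    planeRep (AddMonoidAlgebra.single a c) z =
      c * (Complex.exp (a.1 * Complex.I * z.1) * Complex.exp (a.2 * Complex.I * z.2)) := by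
  rw [planeRep, AddMonoidAlgebra.lift_single]
  rfl

theorem planeRep_symb (z : ℝ × ℝ) : planeRep symb z = disp z := by
  simp only [symb, map_add, ContinuousMap.add_apply, planeRep_single, Prod.fst_zero,
    Prod.snd_zero, Int.cast_zero, Int.cast_one, Int.cast_neg, zero_mul, one_mul, Complex.exp_zero,
    mul_one, disp]
  have h1 := Complex.sin_sq_add_cos_sq z.1
  have h2 := Complex.sin_sq_add_cos_sq z.2
  have e : ∀ x : ℝ, Complex.exp (Complex.I * x) = Complex.cos x + Complex.sin x * Complex.I :=
    fun x => by rw [mul_comm, Complex.exp_mul_I]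
  have e' : ∀ x : ℝ, Complex.exp (-1 * Complex.I * x) =
      Complex.cos x - Complex.sin x * Complex.I := fun x => by
    rw [show -1 * Complex.I * x = (-x : ℂ) * Complex.I by ring, Complex.exp_mul_I, Complex.cos_neg,
      Complex.sin_neg]
    ring
  simp only [e, e']
  push_cast
  linear_combination (-1 : ℂ) * h1 - h2 -
    2 * Complex.sin z.1 * Complex.sin z.2 * Complex.I_sq

/-- A fundamental domain of the plane modulo `2π` in each coordinate. -/
def box : Set (ℝ × ℝ) := Set.Icc (-Real.pi) Real.pi ×ˢ Set.Icc (-Real.pi) Real.pi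

theorem isCompact_box : IsCompact box := isCompact_Icc.prod isCompact_Icc

theorem integrable_restrict_box {E : Type*} [NormedAddCommGroup E] {f : ℝ × ℝ → E}
    (hf : Continuous f) : Integrable f (volume.restrict box) :=
  hf.continuousOn.integrableOn_compact isCompact_box

theorem integral_exp_int_mul (k : ℤ) :
    ∫ x in Set.Icc (-Real.pi) Real.pi, Complex.exp (k * Complex.I * x) =
      if k = 0 then 2 * (Real.pi : ℂ) else 0 := by
  rw [integral_Icc_eq_integral_Ioc, ← intervalIntegral.integral_of_le (by linarith [Real.pi_pos])]
  split_ifs with hk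
  · simp [hk]
    ring
  · rw [integral_exp_mul_complex (by simp [hk])]
    have : Complex.exp (k * Complex.I * (Real.pi : ℝ)) =
        Complex.exp (k * Complex.I * (-Real.pi : ℝ)) := by
      refine Complex.exp_eq_exp_iff_exists_int.2 ⟨k, ?_⟩
      push_cast
      ring
    rw [this, sub_self, zero_div]

theorem integral_planeRep_single (a : ℤ × ℤ) (c : ℂ) :
    ∫ z in box, planeRep (AddMonoidAlgebra.single a c) z =
      if a = 0 then 4 * (Real.pi : ℂ) ^ 2 * c else 0 := by
  simp only [planeRep_single]
  rw [integral_const_mul, box, Measure.volume_eq_prod, ← Measure.prod_restrict,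
    integral_prod_mul (fun x : ℝ => Complex.exp (a.1 * Complex.I * x))
      (fun y : ℝ => Complex.exp (a.2 * Complex.I * y)), integral_exp_int_mul, integral_exp_int_mul]
  by_cases h1 : a.1 = 0 <;> by_cases h2 : a.2 = 0 <;> simp [h1, h2, Prod.ext_iff]
  ring

/-- The vector of `ℓ²(ℤ²)` supported at one point. -/
def pt (x : ℤ × ℤ) : L2Z2 := lp.single 2 x 1

theorem inner_pt (x : ℤ × ℤ) (f : L2Z2) : inner ℂ (pt x) f = f x := by
  rw [pt, lp.inner_single_left]
  simp

theorem pt_apply_self (x : ℤ × ℤ) : pt x x = 1 := lp.single_apply_self ..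

theorem pt_apply_of_ne {x y : ℤ × ℤ} (h : y ≠ x) : pt x y = 0 := lp.single_apply_ne _ _ _ h

/-- A nontrivial even translation has zero diagonal entries, just as a nontrivial character has zero
mean; 4π² is the area of the box. -/
theorem inner_pt_evenRep (x : ℤ × ℤ) (r : Laurent) :
    4 * (Real.pi : ℂ) ^ 2 * inner ℂ (pt x) (evenRep r (pt x)) = ∫ z in box, planeRep r z := by
  induction r using AddMonoidAlgebra.induction_linear with
  | zero => simp
  | add f g hf hg =>
    simp only [map_add, ContinuousMap.add_apply, _root_.add_apply, inner_add_right]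
    rw [integral_add (integrable_restrict_box (planeRep f).continuous)
      (integrable_restrict_box (planeRep g).continuous), mul_add, hf, hg]
  | single a c =>
    obtain ⟨m, n⟩ := x
    rw [integral_planeRep_single, inner_pt, evenRep_single, _root_.smul_apply, lp.coeFn_smul,
      Pi.smul_apply, evenShift_apply, smul_eq_mul]
    split_ifs with h
    · simp [h, pt_apply_self]
    · rw [pt_apply_of_ne]
      · simp
      · contrapose! h
        simp only [Prod.mk.injEq] at h
        exact Prod.ext (by simp; omega) (by simp; omega)

/-- Each of the six steps changes the parity of some coordinate, and even translations cannot undo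
this; hence the odd moments vanish. -/
theorem inner_pt_evenRep_Delta (ω : ℝ) (x : ℤ × ℤ) (r : Laurent) :
    inner ℂ (pt x) (evenRep r (Delta ω (pt x))) = 0 := by
  induction r using AddMonoidAlgebra.induction_linear with
  | zero => simp
  | add f g hf hg => simp only [map_add, _root_.add_apply, inner_add_right, hf, hg, add_zero]
  | single a c =>
    obtain ⟨m, n⟩ := x
    rw [inner_pt, evenRep_single, _root_.smul_apply, lp.coeFn_smul, Pi.smul_apply,
      evenShift_apply, Delta_apply]
    iterate 6 rw [pt_apply_of_ne (by simp only [ne_eq, Prod.mk.injEq]; omega)]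
    simp

/-- The spectral measure of `Δ` at a vector supported at one point. -/
def ptMeasure : Measure ℝ :=
  ENNReal.ofReal (8 * Real.pi ^ 2)⁻¹ •
    ((volume.restrict box).map (fun z => Real.sqrt (disp z)) +
      (volume.restrict box).map (fun z => -Real.sqrt (disp z)))

theorem continuous_sqrt_disp : Continuous fun z => Real.sqrt (disp z) :=
  continuous_disp.sqrt

theorem continuous_neg_sqrt_disp : Continuous fun z => -Real.sqrt (disp z) :=
  continuous_sqrt_disp.neg

instance : IsFiniteMeasure (volume.restrict box) :=
  ⟨by simpa using isCompact_box.measure_lt_top⟩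

instance : IsFiniteMeasure ptMeasure := by
  unfold ptMeasure
  exact Measure.smul_finite _ ENNReal.ofReal_ne_top

theorem ptMeasure_absolutelyContinuous : ptMeasure ≪ volume := by
  refine Measure.AbsolutelyContinuous.smul_left
    (Measure.AbsolutelyContinuous.mk fun s hs h0 => ?_) _
  rw [Measure.add_apply, Measure.map_apply continuous_sqrt_disp.measurable hs,
    Measure.map_apply continuous_neg_sqrt_disp.measurable hs]
  obtain ⟨h1, h2⟩ := volume_sqrt_disp_preimage_eq_zero h0
  rw [Measure.absolutelyContinuous_restrict h1, Measure.absolutelyContinuous_restrict h2, add_zero]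

/-- Any compact interval containing ±√12 would do for the polynomial approximation; 4 is a
convenient bound. -/
theorem ae_ptMeasure_mem_Icc : ∀ᵐ t ∂ptMeasure, t ∈ Set.Icc (-4 : ℝ) 4 := by
  refine Measure.ae_smul_measure (ae_add_measure_iff.2 ⟨?_, ?_⟩) _
  all_goals
    rw [ae_map_iff (p := (· ∈ Set.Icc (-4 : ℝ) 4)) ?_ measurableSet_Icc]
    rotate_left
    · first
      | exact continuous_sqrt_disp.aemeasurable
      | exact continuous_neg_sqrt_disp.aemeasurable
    refine Filter.Eventually.of_forall fun z => ?_
    have h0 := Real.sqrt_nonneg (disp z)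
    have h4 : Real.sqrt (disp z) ≤ 4 :=
      Real.sqrt_le_iff.2 ⟨by norm_num, by linarith [disp_le_twelve z]⟩
    exact ⟨by linarith, by linarith⟩

theorem integral_ptMeasure {f : ℝ → ℝ} (hf : Continuous f) :
    ∫ t, f t ∂ptMeasure = (8 * Real.pi ^ 2)⁻¹ *
      ∫ z in box, (f (Real.sqrt (disp z)) + f (-Real.sqrt (disp z))) := by
  have h1 := integrable_restrict_box (hf.comp continuous_sqrt_disp)
  have h2 := integrable_restrict_box (hf.comp continuous_neg_sqrt_disp)
  have m1 := continuous_sqrt_disp.measurable.aemeasurable (μ := volume.restrict box)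
  have m2 := continuous_neg_sqrt_disp.measurable.aemeasurable (μ := volume.restrict box)
  rw [ptMeasure, integral_smul_measure, integral_add_measure, integral_map m1, integral_map m2,
    ENNReal.toReal_ofReal (by positivity), smul_eq_mul]
  · exact congrArg _ (integral_add h1 h2).symm
  · exact hf.aestronglyMeasurable
  · exact hf.aestronglyMeasurable
  · exact (integrable_map_measure hf.aestronglyMeasurable m1).2 h1
  · exact (integrable_map_measure hf.aestronglyMeasurable m2).2 h2

theorem inner_pt_Delta_pow {ω : ℝ} (hs : Complex.exp (3 * Complex.I * ω) ^ 2 = -1)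
    (x : ℤ × ℤ) (k : ℕ) :
    inner ℂ (pt x) ((Delta ω ^ k) (pt x)) = ((∫ t, t ^ k ∂ptMeasure : ℝ) : ℂ) := by
  rw [integral_ptMeasure (continuous_pow k)]
  obtain ⟨j, rfl | rfl⟩ := k.even_or_odd'
  · have hd : ∀ z, Real.sqrt (disp z) ^ (2 * j) + (-Real.sqrt (disp z)) ^ (2 * j) =
        2 * disp z ^ j := fun z => by
      rw [pow_mul, pow_mul, neg_sq, Real.sq_sqrt (by linarith [three_le_disp z])]
      ring
    have h := inner_pt_evenRep x (symb ^ j)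
    have hint : ∫ z in box, planeRep (symb ^ j) z = ((∫ z in box, disp z ^ j : ℝ) : ℂ) := by
      rw [← integral_complex_ofReal]
      simp [planeRep_symb]
    rw [hint, map_pow, ← Delta_sq hs, ← pow_mul] at h
    simp only [hd]
    rw [integral_const_mul]
    have hpi : (Real.pi : ℂ) ≠ 0 := by exact_mod_cast Real.pi_ne_zero
    generalize inner ℂ (pt x) ((Delta ω ^ (2 * j)) (pt x)) = w at h ⊢
    push_cast
    rw [← h]
    field_simp
    ring
  · have hd : ∀ z, Real.sqrt (disp z) ^ (2 * j + 1) + (-Real.sqrt (disp z)) ^ (2 * j + 1) = 0 :=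
      fun z => by
        rw [Odd.neg_pow ⟨j, rfl⟩]
        ring
    simp only [hd, integral_zero, mul_zero, Complex.ofReal_zero]
    rw [pow_succ, pow_mul, Delta_sq hs, ← map_pow, mul_apply_eq_comp]
    exact inner_pt_evenRep_Delta ω x _

theorem spectrum_subset_Icc {ω : ℝ} (hs : Complex.exp (3 * Complex.I * ω) ^ 2 = -1) :
    spectrum ℝ (Delta ω) ⊆ Set.Icc (-4) 4 := fun t ht =>
  abs_le.1 (abs_le_of_sq_le_sq (by linarith [(sq_mem_Icc_of_mem_spectrum hs ht).2]) (by norm_num))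

theorem isSpectralMeasure_ptMeasure {ω : ℝ} (hs : Complex.exp (3 * Complex.I * ω) ^ 2 = -1)
    (x : ℤ × ℤ) : IsSpectralMeasure (Delta ω) (pt x) ptMeasure := by
  refine isSpectralMeasure_of_forall_polynomial (isSelfAdjoint_Delta ω) (spectrum_subset_Icc hs)
    ae_ptMeasure_mem_Icc fun p => ?_
  have hint : ∀ q : Polynomial ℝ, Integrable (fun t => q.eval t) ptMeasure := fun q => by
    obtain ⟨B, hB⟩ := (isCompact_Icc (a := (-4 : ℝ)) (b := 4)).exists_bound_of_continuousOn
      q.continuous.continuousOn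
    exact Integrable.of_bound q.continuous.aestronglyMeasurable B
      (ae_ptMeasure_mem_Icc.mono fun t ht => hB t ht)
  induction p using Polynomial.induction_on' with
  | add p q hp hq =>
    simp only [map_add, _root_.add_apply, inner_add_right, hp, hq, Polynomial.eval_add]
    rw [integral_add (hint p) (hint q), Complex.ofReal_add]
  | monomial k c =>
    simp only [Polynomial.aeval_monomial, Polynomial.eval_monomial]
    rw [integral_const_mul, Complex.ofReal_mul, ← inner_pt_Delta_pow hs x k,
      ← Algebra.smul_def, _root_.smul_apply, ← Complex.coe_smul, inner_smul_right]

theorem hasPurelyACSpectrum_Delta {ω : ℝ} (hs : Complex.exp (3 * Complex.I * ω) ^ 2 = -1) :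
    HasPurelyACSpectrum (Delta ω) := by
  have hA := isSelfAdjoint_Delta ω
  refine ⟨hA, fun ψ => ?_⟩
  have hψ := lp.hasSum_single (p := 2) (by norm_num) ψ
  refine (isClosed_hasACSpectralMeasure hA).mem_of_tendsto hψ (Filter.Eventually.of_forall
    fun s => (acSubmodule (Delta ω) hA).sum_mem fun x _ => ?_)
  have hx : lp.single 2 x (ψ x) = ψ x • pt x := by
    rw [pt, ← lp.single_smul, smul_eq_mul, mul_one]
  rw [hx]
  exact Submodule.smul_mem _ _ ⟨ptMeasure, isSpectralMeasure_ptMeasure hs x,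
    ptMeasure_absolutelyContinuous⟩

/-! ### The spectrum fills both bands -/

theorem box_subset_closure_interior : box ⊆ closure (interior box) := by
  have hpi := Real.pi_pos
  rw [box, interior_prod_eq, interior_Icc, closure_prod_eq, closure_Ioo (by linarith)]

theorem mem_spectrum_Delta {ω : ℝ} (hs : Complex.exp (3 * Complex.I * ω) ^ 2 = -1) {t : ℝ}
    (h3 : 3 ≤ t ^ 2) (h12 : t ^ 2 ≤ 12) : t ∈ spectrum ℝ (Delta ω) := by
  -- Nontriviality of the space makes the spectrum nonempty.
  have hnt : Nontrivial L2Z2 := ⟨pt 0, 0, fun h => by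
    have := pt_apply_self 0
    rw [h] at this
    simp at this⟩
  have hA := isSelfAdjoint_Delta ω
  have h0 : ptMeasure (spectrum ℝ (Delta ω))ᶜ = 0 :=
    (isSpectralMeasure_ptMeasure hs 0).measure_compl_spectrum
    (ContinuousFunctionalCalculus.spectrum_nonempty (R := ℝ) (Delta ω) hA)
  by_contra ht
  have hopen : IsOpen (spectrum ℝ (Delta ω))ᶜ := (spectrum.isClosed (Delta ω)).isOpen_compl
  have hmeas : MeasurableSet (spectrum ℝ (Delta ω))ᶜ := hopen.measurableSet
  have hpos : ENNReal.ofReal (8 * Real.pi ^ 2)⁻¹ ≠ 0 := by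
    rw [Ne, ENNReal.ofReal_eq_zero, not_le]
    positivity
  rw [ptMeasure, Measure.smul_apply, smul_eq_mul, mul_eq_zero, or_iff_right hpos,
    Measure.add_apply, add_eq_zero,
    Measure.map_apply continuous_sqrt_disp.measurable hmeas,
    Measure.map_apply continuous_neg_sqrt_disp.measurable hmeas] at h0
  obtain ⟨z, hz, hzt⟩ := exists_disp_eq h3 h12
  have key : ∀ f : ℝ × ℝ → ℝ, Continuous f →
      volume.restrict box (f ⁻¹' (spectrum ℝ (Delta ω))ᶜ) = 0 → f z ≠ t := by
    rintro f hf hf0 rfl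
    have hV := hopen.preimage hf
    -- The point z may lie on the boundary of the box; its open neighbourhood still meets the
    -- interior, in a nonempty open set of positive measure.
    obtain ⟨w, hw⟩ := mem_closure_iff.1 (box_subset_closure_interior hz) _ hV ht
    have hp := (hV.inter isOpen_interior).measure_pos volume ⟨w, hw⟩
    rw [Measure.restrict_apply hV.measurableSet] at hf0
    exact hp.ne' (measure_mono_null (Set.inter_subset_inter_right _ interior_subset) hf0)
  have habs : Real.sqrt (disp z) = |t| := by rw [hzt, Real.sqrt_sq_eq_abs]
  rcases abs_choice t with h | h
  · exact key _ continuous_sqrt_disp h0.1 (habs.trans h)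
  · exact key _ continuous_neg_sqrt_disp h0.2 (by rw [habs, h, neg_neg])

theorem mem_bands_iff (t : ℝ) : t ∈ Set.Icc (-(2 * Real.sqrt 3)) (-Real.sqrt 3) ∪
    Set.Icc (Real.sqrt 3) (2 * Real.sqrt 3) ↔ 3 ≤ t ^ 2 ∧ t ^ 2 ≤ 12 := by
  have h0 : 0 < Real.sqrt 3 := by positivity
  have hsq := Real.sq_sqrt (show (0 : ℝ) ≤ 3 by norm_num)
  have h12 : (12 : ℝ) = (2 * Real.sqrt 3) ^ 2 := by rw [mul_pow, hsq]; norm_num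
  -- The first four occurrences of 3 lie under the square roots of the band edges; the fifth is the
  -- bound 3 ≤ t².
  nth_rewrite 5 [← hsq]
  rw [h12, sq_le_sq, sq_le_sq, abs_of_pos h0, abs_of_pos (by positivity : 0 < 2 * Real.sqrt 3)]
  simp only [Set.mem_union, Set.mem_Icc]
  rcases abs_cases t with ⟨h, h'⟩ | ⟨h, h'⟩ <;> rw [h] <;> constructor
  · rintro (⟨_, _⟩ | ⟨_, _⟩) <;> constructor <;> linarith
  · exact Or.inr
  · rintro (⟨_, _⟩ | ⟨_, _⟩) <;> constructor <;> linarith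
  · rintro ⟨_, _⟩
    left
    constructor <;> linarith

end Spectrum

end MagneticLattice

end

theorem mainTheorem6 (ω : ℝ)
    (hω : ∃ k : ℤ, ω = Real.pi / 6 + k * Real.pi ∨ ω = -(Real.pi / 6) + k * Real.pi) :
    MagneticLattice.HasPurelyACSpectrum (MagneticLattice.Delta ω) ∧
      spectrum ℂ (MagneticLattice.Delta ω) =
        Complex.ofReal '' (Set.Icc (-(2 * Real.sqrt 3)) (-Real.sqrt 3) ∪
          Set.Icc (Real.sqrt 3) (2 * Real.sqrt 3)) := by
  have hs := MagneticLattice.exp_three_mul_sq hω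
  refine ⟨MagneticLattice.hasPurelyACSpectrum_Delta hs, ?_⟩
  rw [← (MagneticLattice.isSelfAdjoint_Delta ω).spectrumRestricts.algebraMap_image]
  refine congrArg _ (Set.ext fun t => ?_)
  rw [MagneticLattice.mem_bands_iff]
  exact ⟨MagneticLattice.sq_mem_Icc_of_mem_spectrum hs,
    fun h => MagneticLattice.mem_spectrum_Delta hs h.1 h.2⟩
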